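/- Let $G \le \mathrm{GL}(n,\mathbb{R})$ be a matrix Lie group, i.e. a closed subgroup of $\mathrm{GL}(n,\mathbb{R})$ with matrix multiplication as group product. Let $\mathfrak{g} = T_e G \subseteq \mathbb{R}^{n\times n}$ be its Lie algebra, that is, the space of velocities $\dot\gamma(0)$ of smooth curves $\gamma$ in $G$ with $\gamma(0)=I$. Let $d = \dim \mathfrak{g}$, and for $g\in G$ let $\mathrm{Ad}_g:\mathfrak{g}\to\mathfrak{g}$, $\mathrm{Ad}_g(X) = gXg^{-1}$, be the adjoint action. Fix a basis of $\mathfrak{g}$, let $\mathcal{L}[\mathrm{Ad}_g]\in \mathrm{GL}(d,\mathbb{R})$ be the matrix of $\mathrm{Ad}_g$ in this basis, and put $$\mathcal{L}[\mathrm{Ad}_G] := \{\mathcal{L}[\mathrm{Ad}_g] \mid g\in G\}.$$ If $G$ is compact, then $\mathcal{L}[\mathrm{Ad}_G]$ is a compact, hence closed, subgroup of $\mathrm{GL}(d,\mathbb{R})$. Consequently, $\mathcal{L}[\mathrm{Ad}_G]$ is an embedded matrix Lie subgroup of $\mathrm{GL}(d,\mathbb{R})$: with the subspace topology it carries the structure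 of a finite-dimensional smooth manifold for which it is a Lie group and its inclusion into $\mathrm{GL}(d,\mathbb{R})$ is a smooth embedding. -/

import Mathlib

open scoped Manifold ContDiff Matrix MatrixGroups Matrix.Norms.Operator

noncomputable section

namespace MatrixLie

/-- The Lie algebra `𝔤 = T_e G` of a group `G` of invertible real matrices: the velocities at
`t = 0` of the smooth curves of matrices that run in `G` and pass through the identity at
`t = 0`. -/
def lieAlgebra {n : ℕ} (G : Subgroup (GL (Fin n) ℝ)) :
    Submodule ℝ (Matrix (Fin n) (Fin n) ℝ) where
  carrier := {X | ∃ γ : ℝ → GL (Fin n) ℝ, (∀ t, γ t ∈ G) ∧ γ 0 = 1 ∧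
    ContDiff ℝ ∞ (fun t => (γ t : Matrix (Fin n) (Fin n) ℝ)) ∧
    HasDerivAt (fun t => (γ t : Matrix (Fin n) (Fin n) ℝ)) X 0}
  add_mem' := by
    rintro X Y ⟨γ, hG, h0, hs, hd⟩ ⟨δ, kG, k0, ks, kd⟩
    refine ⟨fun t => γ t * δ t, fun t => G.mul_mem (hG t) (kG t), by simp [h0, k0], ?_, ?_⟩
    · simpa using hs.mul ks
    · have h := HasDerivAt.mul hd kd
      simp only [h0, k0, Units.val_one, mul_one, one_mul] at h
      exact h
  zero_mem' := ⟨fun _ => 1, fun _ => G.one_mem, rfl, contDiff_const, hasDerivAt_const _ _⟩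
  smul_mem' := by
    rintro c X ⟨γ, hG, h0, hs, hd⟩
    refine ⟨fun t => γ (c * t), fun t => hG _, by simp [h0], ?_, ?_⟩
    · exact hs.comp (contDiff_const.mul contDiff_id)
    · have h1 : HasDerivAt (fun t : ℝ => c * t) c 0 := by
        simpa using (hasDerivAt_id (0 : ℝ)).const_mul c
      have h2 : HasDerivAt (fun t => (γ t : Matrix (Fin n) (Fin n) ℝ)) X (c * 0) := by
        simpa using hd
      exact h2.scomp (0 : ℝ) h1

theorem conj_mem_lieAlgebra {n : ℕ} {G : Subgroup (GL (Fin n) ℝ)} {g : GL (Fin n) ℝ}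
    (hg : g ∈ G) {X : Matrix (Fin n) (Fin n) ℝ} (hX : X ∈ lieAlgebra G) :
    (g : Matrix (Fin n) (Fin n) ℝ) * X * (g⁻¹ : GL (Fin n) ℝ) ∈ lieAlgebra G := by
  obtain ⟨γ, hG, h0, hs, hd⟩ := hX
  refine ⟨fun t => g * γ t * g⁻¹, fun t => G.mul_mem (G.mul_mem hg (hG t)) (G.inv_mem hg),
    by simp [h0], ?_, ?_⟩
  · simpa only [Units.val_mul] using (contDiff_const.mul hs).mul contDiff_const
  · exact (HasDerivAt.const_mul _ hd).mul_const _

/-- The adjoint action `Ad_g : 𝔤 → 𝔤`, `Ad_g X = g X g⁻¹`, of an element `g` of `G`. -/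
def Ad {n : ℕ} (G : Subgroup (GL (Fin n) ℝ)) (g : G) : lieAlgebra G →ₗ[ℝ] lieAlgebra G where
  toFun X := ⟨(g : GL (Fin n) ℝ) * (X : Matrix (Fin n) (Fin n) ℝ) *
    ((g : GL (Fin n) ℝ)⁻¹ : GL (Fin n) ℝ), conj_mem_lieAlgebra g.2 X.2⟩
  map_add' X Y := by ext1; simp only [Submodule.coe_add, mul_add, add_mul]
  map_smul' c X := by
    ext1; simp only [Submodule.coe_smul, mul_smul_comm, smul_mul_assoc, RingHom.id_apply]

theorem Ad_comp_Ad_eq_id {n : ℕ} (G : Subgroup (GL (Fin n) ℝ)) {g h : G} (hgh : g * h = 1) :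
    Ad G g ∘ₗ Ad G h = LinearMap.id := by
  obtain rfl : h = g⁻¹ := (inv_eq_of_mul_eq_one_right hgh).symm
  ext1 X
  ext1
  simp [Ad, mul_assoc]

/-- The matrix `L[Ad_g] ∈ GL(d, ℝ)` of the adjoint action of `g` in the basis `b` of `𝔤`. -/
def adMatrix {n d : ℕ} (G : Subgroup (GL (Fin n) ℝ)) (b : Module.Basis (Fin d) ℝ (lieAlgebra G))
    (g : G) : GL (Fin d) ℝ where
  val := LinearMap.toMatrix b b (Ad G g)
  inv := LinearMap.toMatrix b b (Ad G g⁻¹)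
  val_inv := by
    rw [← LinearMap.toMatrix_comp b b b, Ad_comp_Ad_eq_id G (mul_inv_cancel g),
      LinearMap.toMatrix_id]
  inv_val := by
    rw [← LinearMap.toMatrix_comp b b b, Ad_comp_Ad_eq_id G (inv_mul_cancel g),
      LinearMap.toMatrix_id]

/-- The adjoint image `L[Ad_G] = {L[Ad_g] | g ∈ G}`, as a set of invertible matrices. -/
def adjointImage {n d : ℕ} (G : Subgroup (GL (Fin n) ℝ))
    (b : Module.Basis (Fin d) ℝ (lieAlgebra G)) : Set (GL (Fin d) ℝ) :=
  {A | ∃ g : G, A = adMatrix G b g}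

/-- The smooth structure of `GL(d, ℝ)` as an open subset of the space of matrices: Mathlib's
structure on the units of a complete normed ring. (The instance is not found by itself because
the topology of entrywise convergence on matrices and the topology of the operator norm are equal
only after unfolding.) -/
instance instChartedSpaceGL (d : ℕ) :
    @ChartedSpace (Matrix (Fin d) (Fin d) ℝ) PseudoMetricSpace.toUniformSpace.toTopologicalSpace
      (GL (Fin d) ℝ) _ :=
  @Units.instChartedSpace (Matrix (Fin d) (Fin d) ℝ) _ _

instance instLieGroupGL (d : ℕ) :
    LieGroup 𝓘(ℝ, Matrix (Fin d) (Fin d) ℝ) ∞ (GL (Fin d) ℝ) :=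
  @Units.instLieGroupModelWithCornersSelf (Matrix (Fin d) (Fin d) ℝ) _ _ ∞ ℝ _ _

/-- A subgroup `H` of a Lie group `K` is an embedded Lie subgroup if, with the topology induced
from `K`, it carries a structure of a smooth manifold of some finite dimension `k` that makes it a
Lie group and its inclusion into `K` a smooth embedding. -/
def IsEmbeddedLieSubgroup {E M K : Type*} [NormedAddCommGroup E] [NormedSpace ℝ E]
    [TopologicalSpace M] (I : ModelWithCorners ℝ E M) [Group K] [TopologicalSpace K]
    [ChartedSpace M K] [LieGroup I ∞ K] (H : Subgroup K) : Prop :=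
  ∃ (k : ℕ) (_ : ChartedSpace (EuclideanSpace ℝ (Fin k)) H),
    LieGroup (𝓡 k) ∞ H ∧ Manifold.IsSmoothEmbedding (𝓡 k) I ∞ (Subtype.val : H → K)

end MatrixLie

end

/-!
The adjoint representation is a continuous homomorphism, so the image of a compact group is a
compact subgroup of `GL(d, ℝ)`, and a closed subgroup `H` of the units of a finite-dimensional
algebra is an embedded Lie subgroup by Cartan's argument. The tangent cone of `{X | exp X ∈ H}` at
`0` consists of generators of one-parameter groups in `H`, because
`exp (t X) = lim (exp dᵢ) ^ ⌊t cᵢ⌋` when `cᵢ dᵢ → X` and `dᵢ → 0`. Hence it is a linear space `V`,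
and along a complement of `V` the set `{X | exp X ∈ H}` does not accumulate at `0`. In the
coordinates `(v, w) ↦ exp v * exp w` given by the complement, `H` is therefore the slice `w = 0`
near `1`, and left translations carry this slice chart to every point of `H`. The group operations
of `H` are smooth because their compositions with the inclusion, an immersion, are.
-/

noncomputable section

namespace MatrixLie

open Filter Topology NormedSpace

section TangentCone

theorem tangentConeAt_zero_subset_of_isClosed {𝕜 E : Type*} [Ring 𝕜] [AddCommGroup E] [Module 𝕜 E]
    [TopologicalSpace E] {W : Submodule 𝕜 E} (hW : IsClosed (W : Set E)) :
    tangentConeAt 𝕜 (W : Set E) 0 ⊆ W := by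
  intro y hy
  obtain ⟨_, l, _, c, d, -, hd, hcd⟩ := exists_fun_of_mem_tangentConeAt hy
  refine hW.mem_of_tendsto hcd (hd.mono fun i hi => W.smul_mem (c i) ?_)
  simpa using hi

theorem mem_tangentConeAt_of_hasDerivAt {𝕜 E : Type*} [NontriviallyNormedField 𝕜]
    [NormedAddCommGroup E] [NormedSpace 𝕜 E] {γ : 𝕜 → E} {v : E} {t : 𝕜} {s : Set E}
    (hγ : HasDerivAt γ v t) (hs : ∀ᶠ u in 𝓝 t, γ u ∈ s) : v ∈ tangentConeAt 𝕜 s (γ t) := by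
  have hdir : (1 : 𝕜) ∈ tangentConeAt 𝕜 {u | γ u ∈ s} t := by
    rw [tangentConeAt_of_mem_nhds hs]
    exact Set.mem_univ 1
  have himage := hγ.hasFDerivAt.hasFDerivWithinAt.mapsTo_tangent_cone hdir
  simpa using tangentConeAt_mono (Set.image_subset_iff.2 fun _ hu => hu) himage

theorem tendsto_floor_zsmul {ι E : Type*} [NormedAddCommGroup E] [NormedSpace ℝ E] {l : Filter ι}
    {c : ι → ℝ} {d : ι → E} {y : E} (hd : Tendsto d l (𝓝 0))
    (hcd : Tendsto (fun i => c i • d i) l (𝓝 y)) : Tendsto (fun i => ⌊c i⌋ • d i) l (𝓝 y) := by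
  have hfract : Tendsto (fun i => Int.fract (c i) • d i) l (𝓝 0) := by
    refine squeeze_zero_norm (fun i => ?_) (by simpa using hd.norm)
    rw [norm_smul, Real.norm_of_nonneg (Int.fract_nonneg _)]
    exact mul_le_of_le_one_left (norm_nonneg _) (Int.fract_lt_one _).le
  have hfloor : ∀ i, c i • d i - Int.fract (c i) • d i = ⌊c i⌋ • d i := fun i => by
    rw [← sub_smul, Int.self_sub_fract, Int.cast_smul_eq_zsmul]
  simpa only [hfloor, sub_zero] using hcd.sub hfract

end TangentCone

section Exponential

variable {A : Type*} [NormedRing A] [NormedAlgebra ℝ A] [CompleteSpace A]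

theorem exp_mul_exp_neg (X : A) : exp X * exp (-X) = 1 := by
  let : NormedAlgebra ℚ A := .restrictScalars ℚ ℝ A
  rw [← exp_add_of_commute (Commute.refl X).neg_right, add_neg_cancel, exp_zero]

/-- The exponential of a real Banach algebra with values in its group of units, so that membership
of an exponential in a subgroup of the units can be expressed. -/
def expUnit (X : A) : Aˣ where
  val := exp X
  inv := exp (-X)
  val_inv := exp_mul_exp_neg X
  inv_val := by simpa using exp_mul_exp_neg (-X)

@[simp]
theorem val_expUnit (X : A) : (expUnit X : A) = exp X := rfl

@[simp]
theorem expUnit_zero : expUnit (0 : A) = 1 := Units.ext exp_zero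

theorem expUnit_neg (X : A) : expUnit (-X) = (expUnit X)⁻¹ := Units.ext rfl

theorem expUnit_zsmul (m : ℤ) (X : A) : expUnit (m • X) = expUnit X ^ m := by
  let : NormedAlgebra ℚ A := .restrictScalars ℚ ℝ A
  have expUnit_nsmul (k : ℕ) : expUnit (k • X) = expUnit X ^ k := Units.ext (exp_nsmul k X)
  obtain ⟨k, rfl | rfl⟩ := m.eq_nat_or_neg
  · rw [natCast_zsmul, expUnit_nsmul, zpow_natCast]
  · rw [neg_smul, natCast_zsmul, expUnit_neg, expUnit_nsmul, zpow_neg, zpow_natCast]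

theorem continuous_expUnit : Continuous (expUnit : A → Aˣ) := by
  let : NormedAlgebra ℚ A := .restrictScalars ℚ ℝ A
  exact Units.continuous_iff.2 ⟨exp_continuous, exp_continuous.comp continuous_neg⟩

theorem contDiff_exp : ContDiff ℝ ω (exp : A → A) :=
  contDiff_iff_contDiffAt.2 fun X => (exp_analytic (𝕂 := ℝ) X).contDiffAt

theorem exists_local_log :
    ∃ log : A → A, log 1 = 0 ∧ HasFDerivAt log (ContinuousLinearMap.id ℝ A) 1 ∧
      ∀ᶠ y in 𝓝 (1 : A), exp (log y) = y := by
  have hexp : HasStrictFDerivAt (exp : A → A) ((.refl ℝ A : A ≃L[ℝ] A) : A →L[ℝ] A) 0 :=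
    hasStrictFDerivAt_exp_zero
  refine ⟨hexp.localInverse, ?_, ?_, ?_⟩
  · simpa using hexp.localInverse_apply_image
  · simpa using hexp.to_localInverse.hasFDerivAt
  · simpa using hexp.eventually_right_inverse

end Exponential

section ClosedSubgroup

variable {A : Type*} [NormedRing A] [NormedAlgebra ℝ A] [CompleteSpace A] {H : Subgroup Aˣ}

theorem mem_tangentConeAt_expUnit_preimage {γ : ℝ → Aˣ} {X : A} (hγH : ∀ t, γ t ∈ H)
    (hγ0 : γ 0 = 1) (hγ : HasDerivAt (fun t => (γ t : A)) X 0) :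
    X ∈ tangentConeAt ℝ (expUnit ⁻¹' (H : Set Aˣ)) 0 := by
  obtain ⟨log, hlog1, hlog, hexp⟩ := exists_local_log (A := A)
  have hlogγ : HasDerivAt (fun t => log (γ t)) X 0 := by
    rw [← Units.val_one, ← hγ0] at hlog
    exact hlog.comp_hasDerivAt (0 : ℝ) hγ
  have hmem : ∀ᶠ t in 𝓝 (0 : ℝ), log (γ t) ∈ expUnit ⁻¹' (H : Set Aˣ) := by
    have hγ1 : Tendsto (fun t => (γ t : A)) (𝓝 0) (𝓝 1) := by
      simpa [hγ0] using hγ.continuousAt.tendsto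
    filter_upwards [hγ1.eventually hexp] with t ht
    have hγt : expUnit (log (γ t)) = γ t := Units.ext ht
    simpa only [Set.mem_preimage, hγt, SetLike.mem_coe] using hγH t
  simpa [hγ0, hlog1] using mem_tangentConeAt_of_hasDerivAt hlogγ hmem

theorem expUnit_smul_mem_of_mem_tangentConeAt (hH : IsClosed (H : Set Aˣ)) {X : A}
    (hX : X ∈ tangentConeAt ℝ (expUnit ⁻¹' (H : Set Aˣ)) 0) (t : ℝ) : expUnit (t • X) ∈ H := by
  obtain ⟨_, l, _, c, d, hd0, hdH, hcd⟩ := exists_fun_of_mem_tangentConeAt hX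
  have hlim : Tendsto (fun i => ⌊t * c i⌋ • d i) l (𝓝 (t • X)) :=
    tendsto_floor_zsmul hd0 (by simpa only [mul_smul] using hcd.const_smul t)
  refine hH.mem_of_tendsto ((continuous_expUnit.tendsto _).comp hlim) ?_
  filter_upwards [hdH] with i hi
  rw [zero_add] at hi
  simpa only [Function.comp_apply, expUnit_zsmul, SetLike.mem_coe] using H.zpow_mem hi _

/-- The Lie algebra of a closed subgroup of the units of a Banach algebra, encoded as the space of
generators of the one-parameter groups that lie in the subgroup. -/
def oneParameterSubmodule (H : Subgroup Aˣ) (hH : IsClosed (H : Set Aˣ)) : Submodule ℝ A where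
  carrier := {X | ∀ t : ℝ, expUnit (t • X) ∈ H}
  zero_mem' t := by simp [H.one_mem]
  smul_mem' c X hX t := by simpa only [smul_smul] using hX (t * c)
  add_mem' {X Y} hX hY := by
    refine expUnit_smul_mem_of_mem_tangentConeAt hH (mem_tangentConeAt_expUnit_preimage
      (γ := fun t => expUnit (t • X) * expUnit (t • Y)) (fun t => H.mul_mem (hX t) (hY t))
      (by simp) ?_)
    simpa [Pi.mul_def] using
      (hasDerivAt_exp_smul_const X (0 : ℝ)).mul (hasDerivAt_exp_smul_const Y (0 : ℝ))

theorem expUnit_mem_of_mem_oneParameterSubmodule {hH : IsClosed (H : Set Aˣ)} {X : A}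
    (hX : X ∈ oneParameterSubmodule H hH) : expUnit X ∈ H := by
  simpa using hX 1

theorem eventually_eq_zero_of_expUnit_mem [FiniteDimensional ℝ A] (hH : IsClosed (H : Set Aˣ))
    {W : Submodule ℝ A} (hW : Disjoint (oneParameterSubmodule H hH) W) :
    ∀ᶠ y in 𝓝 (0 : A), y ∈ W → expUnit y ∈ H → y = 0 := by
  by_contra hnot
  have hacc : AccPt (0 : A) (𝓟 (W ∩ expUnit ⁻¹' (H : Set Aˣ))) := by
    rw [accPt_iff_frequently]
    refine (not_eventually.1 hnot).mono fun y hy => ?_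
    push Not at hy
    exact ⟨hy.2.2, hy.1, hy.2.1⟩
  have : ProperSpace A := FiniteDimensional.proper ℝ A
  obtain ⟨Y, hY, hY0⟩ := tangentConeAt_nonempty_of_properSpace (𝕜 := ℝ) hacc
  have hYW : Y ∈ W := tangentConeAt_zero_subset_of_isClosed W.closed_of_finiteDimensional
    (tangentConeAt_mono Set.inter_subset_left hY)
  have hYH : Y ∈ oneParameterSubmodule H hH :=
    expUnit_smul_mem_of_mem_tangentConeAt hH (tangentConeAt_mono Set.inter_subset_right hY)
  exact hY0 (Submodule.disjoint_def.1 hW Y hYH hYW)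

end ClosedSubgroup

theorem trans_mem_maximalAtlas {𝕜 E B M N : Type*} [NontriviallyNormedField 𝕜]
    [NormedAddCommGroup E] [NormedSpace 𝕜 E] [TopologicalSpace B] {I : ModelWithCorners 𝕜 E B}
    {n : ℕ∞ω} [TopologicalSpace M] [ChartedSpace B M] [IsManifold I n M] [TopologicalSpace N]
    [ChartedSpace B N] {φ : OpenPartialHomeomorph M N} {ψ : OpenPartialHomeomorph N B}
    (hφ : ContMDiffOn I I n φ φ.source)
    (hφsymm : ContMDiffOn I I n φ.symm φ.target) (hψ : ψ ∈ IsManifold.maximalAtlas I n N) :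
    φ.trans ψ ∈ IsManifold.maximalAtlas I n M := by
  refine OpenPartialHomeomorph.mem_maximalAtlas_of_contMDiffOn _ ?_ ?_
  · rw [φ.trans_source]
    exact (contMDiffOn_of_mem_maximalAtlas hψ).comp (hφ.mono Set.inter_subset_left)
      fun _ hy => hy.2
  · rw [φ.trans_target]
    exact hφsymm.comp ((contMDiffOn_symm_of_mem_maximalAtlas hψ).mono Set.inter_subset_left)
      fun _ hz => hz.2

section SliceCharts

variable {𝕜 E F A M N : Type*} [NontriviallyNormedField 𝕜] [NormedAddCommGroup E]
  [NormedSpace 𝕜 E] [NormedAddCommGroup F] [NormedSpace 𝕜 F] [NormedAddCommGroup A]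
  [NormedSpace 𝕜 A] [TopologicalSpace M] [TopologicalSpace N]

/-- A chart `ψ` is a slice chart of `S` if `S` corresponds in it to the first factor of the
decomposition `e : E × F ≃L[𝕜] A` of the model space. -/
def IsSliceChart (e : (E × F) ≃L[𝕜] A) (S : Set N) (ψ : OpenPartialHomeomorph N A) : Prop :=
  ∀ y ∈ ψ.source, y ∈ S ↔ (e.symm (ψ y)).2 = 0

variable {e : (E × F) ≃L[𝕜] A} {S : Set N} {ψ : OpenPartialHomeomorph N A}

namespace IsSliceChart

theorem trans (h : IsSliceChart e S ψ) {T : Set M} {φ : OpenPartialHomeomorph M N}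
    (hφ : ∀ y ∈ φ.source, φ y ∈ S ↔ y ∈ T) : IsSliceChart e T (φ.trans ψ) := fun y hy => by
  rw [φ.trans_source] at hy
  exact (hφ y hy.1).symm.trans (h (φ y) hy.2)

theorem symm_mem (h : IsSliceChart e S ψ) {u : E} (hu : e (u, 0) ∈ ψ.target) :
    ψ.symm (e (u, 0)) ∈ S := by
  rw [h _ (ψ.map_target hu), ψ.right_inv hu, e.symm_apply_apply]

theorem apply_eq (h : IsSliceChart e S ψ) {y : N} (hy : y ∈ ψ.source) (hyS : y ∈ S) :
    e ((e.symm (ψ y)).1, 0) = ψ y := by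
  rw [← (h y hy).1 hyS, Prod.mk.eta, e.apply_symm_apply]

open Classical in
/-- The chart of `S` with values in `E` that a slice chart of `S` induces. The inverse of a partial
homeomorphism is a total function; off the target it takes the arbitrary value `x`. -/
def restrict (h : IsSliceChart e S ψ) (x : S) : OpenPartialHomeomorph S E where
  toFun y := (e.symm (ψ y)).1
  invFun u := if hu : e (u, 0) ∈ ψ.target then ⟨ψ.symm (e (u, 0)), h.symm_mem hu⟩ else x
  source := Subtype.val ⁻¹' ψ.source
  target := {u | e (u, 0) ∈ ψ.target}
  map_source' y hy := by
    rw [Set.mem_ofPred_eq, h.apply_eq hy y.2]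
    exact ψ.map_source hy
  map_target' u hu := by
    rw [Set.mem_ofPred_eq] at hu
    simp only [dif_pos hu, Set.mem_preimage, ψ.map_target hu]
  left_inv' y hy := by
    have hy' : ψ y ∈ ψ.target := ψ.map_source hy
    simp only [h.apply_eq hy y.2, dif_pos hy', ψ.left_inv hy]
  right_inv' u hu := by
    rw [Set.mem_ofPred_eq] at hu
    simp only [dif_pos hu, ψ.right_inv hu, e.symm_apply_apply]
  open_source := ψ.open_source.preimage continuous_subtype_val
  open_target := ψ.open_target.preimage (by fun_prop)
  continuousOn_toFun :=
    (continuous_fst.comp e.symm.continuous).comp_continuousOn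
      (ψ.continuousOn.comp continuous_subtype_val.continuousOn fun _ hy => hy)
  continuousOn_invFun := by
    rw [IsEmbedding.subtypeVal.continuousOn_iff]
    have hcont : ContinuousOn (fun u : E => ψ.symm (e (u, 0))) {u | e (u, 0) ∈ ψ.target} :=
      ψ.continuousOn_symm.comp (by fun_prop) fun _ hu => hu
    exact hcont.congr fun u hu => congrArg Subtype.val (dif_pos hu)

theorem mem_restrict_target (h : IsSliceChart e S ψ) {x : S} {u : E} :
    u ∈ (h.restrict x).target ↔ e (u, 0) ∈ ψ.target := Iff.rfl

theorem val_restrict_symm (h : IsSliceChart e S ψ) {x : S} {u : E}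
    (hu : u ∈ (h.restrict x).target) : ((h.restrict x).symm u : N) = ψ.symm (e (u, 0)) :=
  congrArg Subtype.val (dif_pos hu)

theorem contDiffOn_restrict_symm_trans {n : ℕ∞ω} [ChartedSpace A N]
    {ψ' : OpenPartialHomeomorph N A} (h : IsSliceChart e S ψ) (h' : IsSliceChart e S ψ')
    (hψ : ψ ∈ IsManifold.maximalAtlas 𝓘(𝕜, A) n N)
    (hψ' : ψ' ∈ IsManifold.maximalAtlas 𝓘(𝕜, A) n N) {x x' : S} :
    ContDiffOn 𝕜 n (h'.restrict x' ∘ (h.restrict x).symm)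
      ((h.restrict x).symm.trans (h'.restrict x')).source := by
  have hsmooth : ContDiffOn 𝕜 n (ψ' ∘ ψ.symm) (ψ.target ∩ ψ.symm ⁻¹' ψ'.source) :=
    ((contMDiffOn_of_mem_maximalAtlas hψ').comp
      ((contMDiffOn_symm_of_mem_maximalAtlas hψ).mono Set.inter_subset_left)
      fun _ hz => hz.2).contDiffOn
  have hincl : ContDiff 𝕜 n fun u : E => e (u, (0 : F)) :=
    e.contDiff.comp (contDiff_prodMk_left 0)
  have hproj : ContDiff 𝕜 n fun a : A => (e.symm a).1 := contDiff_fst.comp e.symm.contDiff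
  refine (hproj.comp_contDiffOn (hsmooth.comp hincl.contDiffOn ?_)).congr ?_
  · rintro u ⟨hu, hu'⟩
    refine ⟨hu, ?_⟩
    rwa [Set.mem_preimage, ← h.val_restrict_symm hu]
  · rintro u ⟨hu, -⟩
    exact congrArg (fun y => (e.symm (ψ' y)).1) (h.val_restrict_symm hu)

end IsSliceChart

/-- The atlas on `S` made of the charts that are induced by a family of slice charts around its
points. -/
abbrev sliceChartedSpace {ψ : S → OpenPartialHomeomorph N A} (hS : ∀ x, IsSliceChart e S (ψ x))
    (hx : ∀ x : S, (x : N) ∈ (ψ x).source) : ChartedSpace E S where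
  atlas := Set.range fun x => (hS x).restrict x
  chartAt x := (hS x).restrict x
  mem_chart_source := hx
  chart_mem_atlas x := ⟨x, rfl⟩

variable {n : ℕ∞ω} [ChartedSpace A N] {ψ : S → OpenPartialHomeomorph N A}

theorem isManifold_sliceChartedSpace (hS : ∀ x, IsSliceChart e S (ψ x))
    (hx : ∀ x : S, (x : N) ∈ (ψ x).source)
    (hψ : ∀ x, ψ x ∈ IsManifold.maximalAtlas 𝓘(𝕜, A) n N) :
    letI := sliceChartedSpace hS hx
    IsManifold 𝓘(𝕜, E) n S := by
  let := sliceChartedSpace hS hx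
  refine isManifold_of_contDiffOn _ _ _ ?_
  rintro _ _ ⟨x, rfl⟩ ⟨y, rfl⟩
  exact ((hS x).contDiffOn_restrict_symm_trans (hS y) (hψ x) (hψ y)).mono Set.inter_subset_left

theorem isSmoothEmbedding_sliceChartedSpace (hS : ∀ x, IsSliceChart e S (ψ x))
    (hx : ∀ x : S, (x : N) ∈ (ψ x).source)
    (hψ : ∀ x, ψ x ∈ IsManifold.maximalAtlas 𝓘(𝕜, A) n N) :
    letI := sliceChartedSpace hS hx
    Manifold.IsSmoothEmbedding 𝓘(𝕜, E) 𝓘(𝕜, A) n (Subtype.val : S → N) := by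
  let := sliceChartedSpace hS hx
  have := isManifold_sliceChartedSpace hS hx hψ
  refine ⟨Manifold.IsImmersionOfComplement.isImmersion (F := F) fun x => ?_, IsEmbedding.subtypeVal⟩
  refine Manifold.IsImmersionAtOfComplement.mk_of_charts e ((hS x).restrict x) (ψ x) (hx x) (hx x)
    (IsManifold.chart_mem_maximalAtlas x) (hψ x) (fun _ hy => hy) fun u hu => ?_
  have hu' : u ∈ ((hS x).restrict x).target := by simpa using hu
  change ψ x (((hS x).restrict x).symm u : S) = e (u, 0)
  rw [(hS x).val_restrict_symm hu', (ψ x).right_inv ((hS x).mem_restrict_target.1 hu')]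

end SliceCharts

section LieSubgroup

variable {𝕜 E F A K : Type*} [NontriviallyNormedField 𝕜] [NormedAddCommGroup E] [NormedSpace 𝕜 E]
  [NormedAddCommGroup F] [NormedSpace 𝕜 F] [NormedAddCommGroup A] [NormedSpace 𝕜 A]
  [Group K] [TopologicalSpace K] [ChartedSpace A K] {n : ℕ∞ω} [LieGroup 𝓘(𝕜, A) n K]
  {H : Subgroup K}

theorem lieGroup_of_isSmoothEmbedding [ChartedSpace E H] [IsManifold 𝓘(𝕜, E) n H]
    (h : Manifold.IsSmoothEmbedding 𝓘(𝕜, E) 𝓘(𝕜, A) n (Subtype.val : H → K)) :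
    LieGroup 𝓘(𝕜, E) n H := by
  have : IsTopologicalGroup K := topologicalGroup_of_lieGroup 𝓘(𝕜, A) n
  exact
    { contMDiff_mul := (ContMDiff.iff_comp_isImmersion h.isImmersion).2
        ⟨continuous_mul, (h.contMDiff.comp contMDiff_fst).mul (h.contMDiff.comp contMDiff_snd)⟩
      contMDiff_inv := (ContMDiff.iff_comp_isImmersion h.isImmersion).2
        ⟨continuous_inv, h.contMDiff.inv⟩ }

theorem exists_isSliceChart_of_isSliceChart_one {e : (E × F) ≃L[𝕜] A}
    {ψ : OpenPartialHomeomorph K A} (hψ : ψ ∈ IsManifold.maximalAtlas 𝓘(𝕜, A) n K)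
    (h1 : 1 ∈ ψ.source) (hs : IsSliceChart e (H : Set K) ψ) (x : H) :
    ∃ φ ∈ IsManifold.maximalAtlas 𝓘(𝕜, A) n K, (x : K) ∈ φ.source ∧
      IsSliceChart e (H : Set K) φ := by
  have : IsTopologicalGroup K := topologicalGroup_of_lieGroup 𝓘(𝕜, A) n
  let τ : OpenPartialHomeomorph K K := (Homeomorph.mulLeft (x : K)⁻¹).toOpenPartialHomeomorph
  have hτ : ContMDiffOn 𝓘(𝕜, A) 𝓘(𝕜, A) n τ τ.source := contMDiff_mul_left.contMDiffOn
  have hτsymm : ContMDiffOn 𝓘(𝕜, A) 𝓘(𝕜, A) n τ.symm τ.target := contMDiff_mul_left.contMDiffOn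
  refine ⟨τ.trans ψ, trans_mem_maximalAtlas hτ hτsymm hψ, ⟨trivial, ?_⟩,
    hs.trans fun y _ => H.mul_mem_cancel_left (H.inv_mem x.2)⟩
  simpa [τ] using h1

end LieSubgroup

theorem isEmbeddedLieSubgroup_of_isSliceChart_one {F A K : Type*} [NormedAddCommGroup F]
    [NormedSpace ℝ F] [NormedAddCommGroup A] [NormedSpace ℝ A] [Group K] [TopologicalSpace K]
    [ChartedSpace A K] [LieGroup 𝓘(ℝ, A) ∞ K] {H : Subgroup K} {k : ℕ}
    {e : (EuclideanSpace ℝ (Fin k) × F) ≃L[ℝ] A} {ψ : OpenPartialHomeomorph K A}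
    (hψ : ψ ∈ IsManifold.maximalAtlas 𝓘(ℝ, A) ∞ K) (h1 : 1 ∈ ψ.source)
    (hs : IsSliceChart e (H : Set K) ψ) : IsEmbeddedLieSubgroup 𝓘(ℝ, A) H := by
  choose φ hφ hx hsφ using exists_isSliceChart_of_isSliceChart_one hψ h1 hs
  let := sliceChartedSpace hsφ hx
  have := isManifold_sliceChartedSpace hsφ hx hφ
  have hemb := isSmoothEmbedding_sliceChartedSpace hsφ hx hφ
  exact ⟨k, inferInstance, lieGroup_of_isSmoothEmbedding (H := H) hemb, hemb⟩

section Coordinates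

theorem exists_openPartialHomeomorph_contDiffOn_symm {𝕂 E F : Type*} [RCLike 𝕂]
    [NormedAddCommGroup E] [NormedSpace 𝕂 E] [CompleteSpace E] [NormedAddCommGroup F]
    [NormedSpace 𝕂 F] {n : ℕ∞ω} (hn : n ≠ 0) (hn' : n ≠ ∞) {f : E → F} {f' : E ≃L[𝕂] F} {a : E}
    (hf : ContDiffAt 𝕂 n f a) (hf' : HasFDerivAt f (f' : E →L[𝕂] F) a) :
    ∃ Φ : OpenPartialHomeomorph E F, a ∈ Φ.source ∧ Φ = f ∧ ContDiffOn 𝕂 n Φ.symm Φ.target := by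
  let Φ := hf.toOpenPartialHomeomorph f hf' hn
  have hsymm : ContDiffAt 𝕂 n Φ.symm (f a) := hf.to_localInverse hf' hn
  obtain ⟨U, hU, hUopen, haU⟩ := eventually_nhds_iff.1 (hsymm.eventually hn')
  refine ⟨(Φ.symm.restrOpen U hUopen).symm, ?_, rfl, fun y hy => (hU y hy.2).contDiffWithinAt⟩
  exact ⟨hf.mem_toOpenPartialHomeomorph_source hf' hn, haU⟩

variable {A E F : Type*} [NormedRing A] [NormedAlgebra ℝ A] [CompleteSpace A]
  [NormedAddCommGroup E] [NormedSpace ℝ E] [NormedAddCommGroup F] [NormedSpace ℝ F]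

/-- The coordinates `u + w ↦ exp u * exp w` near `1` on the units of a Banach algebra, where
`u + w` refers to the decomposition `e` of the algebra. -/
def splitExp (e : (E × F) ≃L[ℝ] A) (Z : A) : Aˣ :=
  expUnit (e ((e.symm Z).1, 0)) * expUnit (e (0, (e.symm Z).2))

theorem splitExp_zero (e : (E × F) ≃L[ℝ] A) : splitExp e 0 = 1 := by
  simp [splitExp, Prod.mk_zero_zero]

theorem contDiff_splitExp (e : (E × F) ≃L[ℝ] A) : ContDiff ℝ ω fun Z => (splitExp e Z : A) := by
  have hfst : ContDiff ℝ ω fun Z => e ((e.symm Z).1, 0) := by fun_prop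
  have hsnd : ContDiff ℝ ω fun Z => e (0, (e.symm Z).2) := by fun_prop
  exact (contDiff_exp.comp hfst).mul (contDiff_exp.comp hsnd)

theorem hasFDerivAt_splitExp_zero (e : (E × F) ≃L[ℝ] A) :
    HasFDerivAt (fun Z => (splitExp e Z : A)) (ContinuousLinearMap.id ℝ A) 0 := by
  have hexp (R : A →L[ℝ] A) : HasFDerivAt (fun Z => exp (R Z)) R 0 := by
    have h : HasFDerivAt (exp : A → A) (1 : A →L[ℝ] A) (R 0) := by
      simpa using hasFDerivAt_exp_zero (𝕂 := ℝ) (𝔸 := A)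
    exact h.comp (0 : A) R.hasFDerivAt
  let P : A →L[ℝ] A := e ∘L .inl ℝ E F ∘L .fst ℝ E F ∘L e.symm
  let Q : A →L[ℝ] A := e ∘L .inr ℝ E F ∘L .snd ℝ E F ∘L e.symm
  have hPQ (Z : A) : P Z + Q Z = Z := by
    simp [P, Q, ← map_add]
  refine ((hexp P).mul' (hexp Q)).congr_fderiv ?_
  ext Z
  simpa [add_comm] using hPQ Z

theorem splitExp_mem_iff {H : Subgroup Aˣ} {hH : IsClosed (H : Set Aˣ)} {e : (E × F) ≃L[ℝ] A}
    (he : ∀ p, e p ∈ oneParameterSubmodule H hH ↔ p.2 = 0) {Z : A} :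
    splitExp e Z ∈ H ↔ expUnit (e (0, (e.symm Z).2)) ∈ H :=
  H.mul_mem_cancel_left (expUnit_mem_of_mem_oneParameterSubmodule ((he _).2 rfl))

theorem eventually_splitExp_mem_iff [FiniteDimensional ℝ A] {H : Subgroup Aˣ}
    {hH : IsClosed (H : Set Aˣ)} {e : (E × F) ≃L[ℝ] A}
    (he : ∀ p, e p ∈ oneParameterSubmodule H hH ↔ p.2 = 0) :
    ∀ᶠ Z in 𝓝 (0 : A), splitExp e Z ∈ H ↔ (e.symm Z).2 = 0 := by
  let W : Submodule ℝ A := LinearMap.range (e.toLinearMap ∘ₗ LinearMap.inr ℝ E F)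
  have hdisj : Disjoint (oneParameterSubmodule H hH) W := by
    rw [Submodule.disjoint_def]
    rintro _ hw ⟨w, rfl⟩
    have hw0 : w = 0 := (he (0, w)).1 hw
    simp [hw0]
  have hlim : Tendsto (fun Z => e (0, (e.symm Z).2)) (𝓝 0) (𝓝 0) := by
    have hcont : Continuous fun Z => e (0, (e.symm Z).2) := by fun_prop
    simpa [Prod.mk_zero_zero] using hcont.tendsto 0
  filter_upwards [hlim.eventually (eventually_eq_zero_of_expUnit_mem hH hdisj)] with Z hZ
  rw [splitExp_mem_iff he]
  refine ⟨fun hmem => ?_, fun h0 => by simp [h0, Prod.mk_zero_zero, H.one_mem]⟩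
  simpa using hZ ⟨_, rfl⟩ hmem

theorem exists_isSliceChart_image_val [FiniteDimensional ℝ A] {H : Subgroup Aˣ}
    {hH : IsClosed (H : Set Aˣ)} {e : (E × F) ≃L[ℝ] A}
    (he : ∀ p, e p ∈ oneParameterSubmodule H hH ↔ p.2 = 0) :
    ∃ ψ ∈ IsManifold.maximalAtlas 𝓘(ℝ, A) ω A, 1 ∈ ψ.source ∧
      IsSliceChart e (Units.val '' (H : Set Aˣ)) ψ := by
  obtain ⟨Φ, h0, hΦ, hΦsymm⟩ := exists_openPartialHomeomorph_contDiffOn_symm (by simp) (by simp)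
    (contDiff_splitExp e).contDiffAt (f' := .refl ℝ A) (hasFDerivAt_splitExp_zero e)
  obtain ⟨U, hU, hUopen, h0U⟩ := eventually_nhds_iff.1 (eventually_splitExp_mem_iff he)
  let Ψ := Φ.restrOpen U hUopen
  have hΨ (Z : A) : Ψ Z = splitExp e Z := congrFun hΦ Z
  refine ⟨Ψ.symm, OpenPartialHomeomorph.mem_maximalAtlas_of_contMDiffOn _ ?_ ?_, ?_, fun x hx => ?_⟩
  · exact (hΦsymm.mono Set.inter_subset_left).contMDiffOn
  · exact ((contDiff_splitExp e).contDiffOn.congr fun Z _ => hΨ Z).contMDiffOn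
  · rw [← Units.val_one, ← splitExp_zero e, ← hΨ]
    exact Ψ.map_source ⟨h0, h0U⟩
  · have hxΨ : (splitExp e (Ψ.symm x) : A) = x := (hΨ _).symm.trans (Ψ.right_inv hx)
    rw [← hU _ (Ψ.map_target hx).2]
    nth_rewrite 1 [← hxΨ]
    exact Units.val_injective.mem_set_image

theorem exists_isSliceChart_one [FiniteDimensional ℝ A] {H : Subgroup Aˣ}
    {hH : IsClosed (H : Set Aˣ)} {e : (E × F) ≃L[ℝ] A}
    (he : ∀ p, e p ∈ oneParameterSubmodule H hH ↔ p.2 = 0) :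
    ∃ ψ ∈ IsManifold.maximalAtlas 𝓘(ℝ, A) ω Aˣ, 1 ∈ ψ.source ∧
      IsSliceChart e (H : Set Aˣ) ψ := by
  obtain ⟨ψ, hψ, h1, hs⟩ := exists_isSliceChart_image_val he
  refine ⟨(chartAt A (1 : Aˣ)).trans ψ,
    trans_mem_maximalAtlas contMDiffOn_chart contMDiffOn_chart_symm hψ,
    ⟨mem_chart_source A 1, h1⟩, hs.trans fun y _ => Units.val_injective.mem_set_image⟩

end Coordinates

theorem exists_continuousLinearEquiv_mem_iff {𝕜 A : Type*} [RCLike 𝕜] [NormedAddCommGroup A]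
    [NormedSpace 𝕜 A] [FiniteDimensional 𝕜 A] (V : Submodule 𝕜 A) :
    ∃ (W : Submodule 𝕜 A) (e : (EuclideanSpace 𝕜 (Fin (Module.finrank 𝕜 V)) × W) ≃L[𝕜] A),
      ∀ p, e p ∈ V ↔ p.2 = 0 := by
  obtain ⟨W, hVW⟩ := V.exists_isCompl
  let coord : EuclideanSpace 𝕜 (Fin (Module.finrank 𝕜 V)) ≃ₗ[𝕜] V := .ofFinrankEq _ _ (by simp)
  refine ⟨W, ((coord.prodCongr (.refl 𝕜 W)).trans
    (V.prodEquivOfIsCompl W hVW)).toContinuousLinearEquiv, fun ⟨u, w⟩ => ?_⟩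
  have hw : (w : A) ∈ V ↔ w = 0 :=
    ⟨fun hwV => Subtype.ext (Submodule.disjoint_def.1 hVW.disjoint w hwV w.2),
      fun hw0 => by simp [hw0]⟩
  simpa using (V.add_mem_iff_right (coord u).2).trans hw

theorem isEmbeddedLieSubgroup_of_isClosed {A : Type*} [NormedRing A] [NormedAlgebra ℝ A]
    [CompleteSpace A] [FiniteDimensional ℝ A] {H : Subgroup Aˣ} (hH : IsClosed (H : Set Aˣ)) :
    IsEmbeddedLieSubgroup 𝓘(ℝ, A) H := by
  obtain ⟨W, e, he⟩ := exists_continuousLinearEquiv_mem_iff (oneParameterSubmodule H hH)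
  obtain ⟨ψ, hψ, h1, hs⟩ := exists_isSliceChart_one he
  exact isEmbeddedLieSubgroup_of_isSliceChart_one
    (IsManifold.maximalAtlas_subset_of_le (by simp) hψ) h1 hs

section AdjointImage

variable {n d : ℕ} (G : Subgroup (GL (Fin n) ℝ)) (b : Module.Basis (Fin d) ℝ (lieAlgebra G))

theorem Ad_mul (g h : G) : Ad G (g * h) = Ad G g ∘ₗ Ad G h := by
  ext X
  simp [Ad, mul_assoc]

theorem adMatrix_mul (g h : G) : adMatrix G b (g * h) = adMatrix G b g * adMatrix G b h :=
  Units.ext <| (congrArg (LinearMap.toMatrix b b) (Ad_mul G g h)).trans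
    (LinearMap.toMatrix_comp b b b _ _)

/-- The adjoint representation of `G` in the basis `b` of its Lie algebra, as a group
homomorphism. -/
def adMatrixHom : G →* GL (Fin d) ℝ := MonoidHom.mk' (adMatrix G b) (adMatrix_mul G b)

theorem coe_range_adMatrixHom :
    ((adMatrixHom G b).range : Set (GL (Fin d) ℝ)) = adjointImage G b :=
  Set.ext fun _ => exists_congr fun _ => eq_comm

theorem continuous_Ad_apply (X : lieAlgebra G) : Continuous fun g : G => Ad G g X := by
  have hval : Continuous fun g : G => ((g : GL (Fin n) ℝ) : Matrix (Fin n) (Fin n) ℝ) :=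
    Units.continuous_val.comp continuous_subtype_val
  have hinv : Continuous fun g : G =>
      (((g : GL (Fin n) ℝ)⁻¹ : GL (Fin n) ℝ) : Matrix (Fin n) (Fin n) ℝ) :=
    Units.continuous_val.comp (continuous_inv.comp continuous_subtype_val)
  exact ((hval.mul continuous_const).mul hinv).subtype_mk _

theorem continuous_toMatrix_Ad : Continuous fun g : G => LinearMap.toMatrix b b (Ad G g) := by
  refine continuous_matrix fun i j => ?_
  simp only [LinearMap.toMatrix_apply]
  exact (b.coord i).continuous_of_finiteDimensional.comp (continuous_Ad_apply G (b j))

theorem continuous_adMatrixHom : Continuous (adMatrixHom G b) :=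
  Units.continuous_iff.2 ⟨continuous_toMatrix_Ad G b,
    (continuous_toMatrix_Ad G b).comp continuous_inv⟩

end AdjointImage

end MatrixLie

end

theorem mainTheorem8 {n d : ℕ} (G : Subgroup (GL (Fin n) ℝ))
    (hG : IsCompact (G : Set (GL (Fin n) ℝ)))
    (b : Module.Basis (Fin d) ℝ (MatrixLie.lieAlgebra G)) :
    ∃ H : Subgroup (GL (Fin d) ℝ),
      (H : Set (GL (Fin d) ℝ)) = MatrixLie.adjointImage G b ∧
      IsCompact (H : Set (GL (Fin d) ℝ)) ∧
      IsClosed (H : Set (GL (Fin d) ℝ)) ∧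
      MatrixLie.IsEmbeddedLieSubgroup 𝓘(ℝ, Matrix (Fin d) (Fin d) ℝ) H := by
  have : CompactSpace G := isCompact_iff_compactSpace.1 hG
  have hcompact : IsCompact ((MatrixLie.adMatrixHom G b).range : Set (GL (Fin d) ℝ)) := by
    rw [MonoidHom.coe_range]
    exact isCompact_range (MatrixLie.continuous_adMatrixHom G b)
  exact ⟨(MatrixLie.adMatrixHom G b).range, MatrixLie.coe_range_adMatrixHom G b, hcompact,
    hcompact.isClosed, MatrixLie.isEmbeddedLieSubgroup_of_isClosed
      (A := Matrix (Fin d) (Fin d) ℝ) hcompact.isClosed⟩
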